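/- Let $t_1<\dots<t_9$ be real numbers, let $P_i=(t_i,t_i^2,\dots,t_i^6)\in\mathbb{R}^6$, and let $C_6(9)$ be the cyclic polytope, that is, the convex hull of $P_1,\dots,P_9$. It is a simplicial polytope with these nine vertices; let $K=\partial C_6(9)$ be its boundary complex, regarded as a simplicial complex on $\{1,\dots,9\}$ (together with the empty simplex). Let $$Z_K=\bigcup_{\sigma\in K}\{z\in\mathbb{C}^9 : |z_i|\le 1 \text{ for } i\in\sigma,\ |z_i|=1\text{ for } i\notin\sigma\}$$ be its moment-angle complex, on which the torus $T^9=(S^1)^9$ acts by coordinatewise multiplication. A $d$-dimensional subtorus of $T^9$ is a subgroup that, with the subspace topology, is isomorphic to $(S^1)^d$ as a topological group. Let $T\subset T^9$ be the image of the homomorphism $(S^1)^2\to T^9$, $(s_1,s_2)\mapsto (s_1^{a_{1i}}s_2^{a_{2i}})_{1\le i\le 9}$, defined by the matrix $$(a_{ji})=\begin{pmatrix}1&0&1&0&1&0&1&0&1\\0&1&0&1&0&1&0&1&1\end{pmatrix}.$$ Then $T$ is a 2-dimensional subtorus of $T^9$ that acts freely on $Z_{\partial C_6(9)}$, and it is maximal,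 with respect to inclusion, among the subtori of $T^9$ acting freely on $Z_{\partial C_6(9)}$. Moreover, no 3-dimensional subtorus of $T^9$ acts freely on $Z_{\partial C_6(9)}$. -/

import Mathlib

noncomputable section

/-- The point `(s, s², …, sⁿ)` of the moment curve in `ℝⁿ`. -/
def momentCurve (n : ℕ) (s : ℝ) : EuclideanSpace ℝ (Fin n) :=
  WithLp.toLp 2 fun j => s ^ (j.val + 1)

/-- The cyclic polytope `C_n(m)` with vertices `P_i = (t_i, t_i², …, t_iⁿ)`: the convex hull of the
points `P_i` (to be used with `t_1 < ⋯ < t_m`). -/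
def cyclicPolytope (n : ℕ) {m : ℕ} (t : Fin m → ℝ) : Set (EuclideanSpace ℝ (Fin n)) :=
  convexHull ℝ (Set.range fun i => momentCurve n (t i))

/-- The boundary complex `∂C_n(m)` as an abstract simplicial complex on the index set of the
vertices: a nonempty `σ` is a simplex iff the `P_i`, `i ∈ σ`, lie on a common proper face of the
polytope, where a face is the intersection with a supporting hyperplane (an exposed subset). As
cyclic polytopes are simplicial, these are the vertex sets of the nonempty proper faces. -/
def cyclicBoundary (n : ℕ) {m : ℕ} (t : Fin m → ℝ) : PreAbstractSimplicialComplex (Fin m) where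
  faces := {σ | σ.Nonempty ∧ ∃ F : Set (EuclideanSpace ℝ (Fin n)),
    IsExposed ℝ (cyclicPolytope n t) F ∧ F ≠ cyclicPolytope n t ∧
      ∀ i ∈ σ, momentCurve n (t i) ∈ F}
  isRelLowerSet_faces := by
    rintro σ ⟨hσ, F, hF, hne, h⟩
    exact ⟨hσ, fun τ hτσ hτ => ⟨hτ, F, hF, hne, fun i hi => h i (hτσ hi)⟩⟩

/-- The piece `Z_σ = X_1 × ⋯ × X_m`, with `X_i` the closed unit disc `D²` for `i ∈ σ` and the unit
circle `S¹` for `i ∉ σ`. -/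
def momentAnglePiece {m : ℕ} (σ : Finset (Fin m)) : Set (Fin m → ℂ) :=
  {z | ∀ i, (i ∈ σ → ‖z i‖ ≤ 1) ∧ (i ∉ σ → ‖z i‖ = 1)}

/-- The moment-angle complex `Z_K`, the union of the `Z_σ` over all simplices `σ` of `K`, the empty
simplex included. -/
def momentAngleComplex {m : ℕ} (K : PreAbstractSimplicialComplex (Fin m)) : Set (Fin m → ℂ) :=
  {z | ∃ σ : Finset (Fin m), (σ = ∅ ∨ σ ∈ K.faces) ∧ z ∈ momentAnglePiece σ}

/-- The torus `T^m = (S¹)^m`. -/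
abbrev Torus (m : ℕ) : Type := Fin m → Circle

/-- The coordinatewise action of `T^m` on `Z_K`. -/
instance momentAngleAction {m : ℕ} (K : PreAbstractSimplicialComplex (Fin m)) :
    MulAction (Torus m) (momentAngleComplex K) where
  smul g z := ⟨fun i => (g i : ℂ) * z.1 i, by
    obtain ⟨z, σ, hσ, hz⟩ := z
    exact ⟨σ, hσ, fun i => by simpa only [norm_mul, Circle.norm_coe, one_mul] using hz i⟩⟩
  one_smul z := Subtype.ext (funext fun i => by
    change ((1 : Circle) : ℂ) * z.1 i = z.1 i
    simp)
  mul_smul g h z := Subtype.ext (funext fun i => by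
    change ((g i * h i : Circle) : ℂ) * z.1 i = (g i : ℂ) * ((h i : ℂ) * z.1 i)
    simp [mul_assoc])

/-- The subgroup `H` of `T^m` acts freely on `Z_K`: all stabilizers are trivial. -/
def ActsFreelyOn {m : ℕ} (H : Subgroup (Torus m)) (K : PreAbstractSimplicialComplex (Fin m)) :
    Prop :=
  ∀ g ∈ H, ∀ z : momentAngleComplex K, g • z = z → g = 1

/-- `H` is a `d`-dimensional subtorus of `T^m`: with the subspace topology, it is isomorphic to
`T^d` as a topological group. -/
def IsSubtorusOfDim {m : ℕ} (H : Subgroup (Torus m)) (d : ℕ) : Prop :=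
  Nonempty (Torus d ≃ₜ* H)

/-- `H` is a subtorus of `T^m`, of some dimension. -/
def IsSubtorus {m : ℕ} (H : Subgroup (Torus m)) : Prop :=
  ∃ d : ℕ, IsSubtorusOfDim H d

/-- The homomorphism `T^k → T^m` defined by an integer `k × m` matrix `A`: the `i`-th coordinate of
the image of `s` is `∏ j, s_j ^ A_{j i}`. -/
def torusHom {k m : ℕ} (A : Matrix (Fin k) (Fin m) ℤ) : Torus k →* Torus m where
  toFun s i := ∏ j, s j ^ A j i
  map_one' := by
    funext i
    simp
  map_mul' s u := by
    funext i
    simp [mul_zpow, Finset.prod_mul_distrib]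

/-- The matrix that defines the subtorus of `T^9`. -/
def subtorusMatrix : Matrix (Fin 2) (Fin 9) ℤ :=
  !![1, 0, 1, 0, 1, 0, 1, 0, 1;
     0, 1, 0, 1, 0, 1, 0, 1, 1]

end

/-! A linear functional on the moment curve is a polynomial of degree at most 6, so simplices of
`∂C_6(9)` are sets of zeros of such polynomials that are nonnegative, but not all zero, at the
`t_i`.

Freeness: an element with a fixed point in `Z_σ` is 1 off `σ`. Among the first eight vertices, `σ`
cannot contain all of one parity: divided differences would force the polynomial to vanish
(`eq_zero_of_alternating`). So `σ` misses a column `(1,0)` and a column `(0,1)` of the matrix, and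
both parameters are 1.

Dimension bound: the 2-torsion of a 3-torus in `T^9` gives a `3 × 9` matrix over `𝔽₂`. Freeness
makes the three columns off each facet independent. The facets formed by three cyclically adjacent
pairs already make this impossible (`exists_det_eq_zero_of_adjacent_pairs`). A free torus of larger
dimension would contain a 3-torus.

Maximality: a free subtorus containing `T` has dimension at most 2, and counting torsion shows that
it equals `T` (`IsSubtorusOfDim.le_of_le`). -/

noncomputable section

/-! ### Faces of the cyclic polytope as polynomials -/

open Polynomial in
/-- A continuous linear functional restricted to the moment curve is a polynomial. -/
theorem exists_polynomial_of_functional {n : ℕ} (l : EuclideanSpace ℝ (Fin n) →L[ℝ] ℝ) (c : ℝ) :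
    ∃ q : ℝ[X], q.natDegree ≤ n ∧ ∀ s, q.eval s = c - l (momentCurve n s) := by
  refine ⟨C c - ∑ j : Fin n, C (l (EuclideanSpace.single j 1)) * X ^ (j.val + 1), ?_, fun s => ?_⟩
  · refine (natDegree_sub_le _ _).trans (max_le (by simp) ?_)
    refine natDegree_sum_le_of_forall_le _ _ fun j _ => ?_
    exact (natDegree_C_mul_X_pow_le _ _).trans j.isLt
  · have h : momentCurve n s = ∑ j : Fin n, s ^ (j.val + 1) • EuclideanSpace.single j (1 : ℝ) := by
      ext i
      simp [momentCurve, Finset.sum_apply, Pi.single_apply]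
    rw [h, map_sum]
    simp only [eval_sub, eval_C, eval_finsetSum, eval_mul, eval_pow, eval_X, map_smul, smul_eq_mul,
      mul_comm]

open Polynomial in
/-- A polynomial of degree at most `n` that is nonnegative, but not identically zero, on the
parameters `t_i` cuts out a proper face of the cyclic polytope. -/
theorem mem_cyclicBoundary_of_polynomial {n m : ℕ} {t : Fin m → ℝ} {q : ℝ[X]}
    (hdeg : q.natDegree ≤ n) (hq : ∀ i, 0 ≤ q.eval (t i)) (hne : ∃ k, q.eval (t k) ≠ 0)
    {σ : Finset (Fin m)} (hσ : σ.Nonempty) (hzero : ∀ i ∈ σ, q.eval (t i) = 0) :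
    σ ∈ (cyclicBoundary n t).faces := by
  -- An exposed face is where a functional is maximal, while `q` is minimal on `σ`; hence the minus
  -- sign.
  let l : EuclideanSpace ℝ (Fin n) →L[ℝ] ℝ :=
    -∑ j : Fin n, q.coeff (j.val + 1) • EuclideanSpace.proj j
  have hl : ∀ s, l (momentCurve n s) = q.coeff 0 - q.eval s := by
    intro s
    rw [eval_eq_sum_range' (Nat.lt_succ_of_le hdeg), Finset.sum_range_succ', Finset.sum_range]
    simp [l, momentCurve]
  have hle : ∀ y ∈ cyclicPolytope n t, l y ≤ q.coeff 0 := by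
    intro y hy
    refine convexHull_min ?_ (convex_halfSpace_le l.isLinear (q.coeff 0)) hy
    rintro _ ⟨i, rfl⟩
    change l _ ≤ q.coeff 0
    rw [hl]
    linarith [hq i]
  have hmem : ∀ i, momentCurve n (t i) ∈ cyclicPolytope n t := fun i =>
    subset_convexHull ℝ _ ⟨i, rfl⟩
  have hmax : ∀ i, q.eval (t i) = 0 → l (momentCurve n (t i)) = q.coeff 0 := fun i hi => by
    rw [hl, hi, sub_zero]
  refine ⟨hσ, {x ∈ cyclicPolytope n t | ∀ y ∈ cyclicPolytope n t, l y ≤ l x}, fun _ => ⟨l, rfl⟩,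
    fun heq => ?_, fun i hi => ⟨hmem i, fun y hy => ?_⟩⟩
  · obtain ⟨k, hk⟩ := hne
    obtain ⟨i, hi⟩ := hσ
    have h := (heq.symm ▸ hmem k : momentCurve n (t k) ∈ {x ∈ cyclicPolytope n t |
      ∀ y ∈ cyclicPolytope n t, l y ≤ l x}).2 _ (hmem i)
    rw [hmax i (hzero i hi), hl] at h
    exact hk (le_antisymm (by linarith) (hq k))
  · rw [hmax i (hzero i hi)]
    exact hle y hy

open Polynomial in
/-- Every simplex of the boundary complex is cut out by such a polynomial. -/
theorem exists_polynomial_of_mem_cyclicBoundary {n m : ℕ} {t : Fin m → ℝ} {σ : Finset (Fin m)}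
    (h : σ ∈ (cyclicBoundary n t).faces) :
    ∃ q : ℝ[X], q.natDegree ≤ n ∧ (∀ i, 0 ≤ q.eval (t i)) ∧ (∃ k, q.eval (t k) ≠ 0) ∧
      ∀ i ∈ σ, q.eval (t i) = 0 := by
  obtain ⟨⟨i, hi⟩, F, hF, hne, hσ⟩ := h
  obtain ⟨l, rfl⟩ := hF ⟨_, hσ i hi⟩
  obtain ⟨q, hdeg, hq⟩ := exists_polynomial_of_functional l (l (momentCurve n (t i)))
  have hmem : ∀ j, momentCurve n (t j) ∈ cyclicPolytope n t := fun j =>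
    subset_convexHull ℝ _ ⟨j, rfl⟩
  refine ⟨q, hdeg, fun j => ?_, ?_, fun j hj => ?_⟩
  · rw [hq]
    exact sub_nonneg.2 ((hσ i hi).2 _ (hmem j))
  -- If `q` vanished at every parameter, `l` would be constant on the polytope and the face would
  -- not be proper.
  · by_contra! hall
    refine hne (Set.Subset.antisymm (fun x hx => hx.1) fun x hx => ⟨hx, fun y hy => ?_⟩)
    have hconst : ∀ z ∈ cyclicPolytope n t, l z = l (momentCurve n (t i)) := by
      intro z hz
      refine convexHull_min ?_ (convex_hyperplane l.isLinear (l (momentCurve n (t i)))) hz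
      rintro _ ⟨j, rfl⟩
      have := hall j
      rw [hq] at this
      change l _ = _
      linarith
    rw [hconst x hx, hconst y hy]
  · rw [hq]
    exact sub_eq_zero.2 (le_antisymm ((hσ j hj).2 _ (hmem i)) ((hσ i hi).2 _ (hmem j)))

/-! ### Parity obstruction for simplices -/

theorem sign_mul_prod_sub_pos {ι : Type*} [Fintype ι] [LinearOrder ι] {v : ι → ℝ}
    (hv : StrictMono v) (i : ι) :
    0 < (∏ j ∈ Finset.univ.erase i, if i < j then (-1 : ℝ) else 1) *
      ∏ j ∈ Finset.univ.erase i, (v i - v j) := by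
  rw [← Finset.prod_mul_distrib]
  refine Finset.prod_pos fun j hj => ?_
  rcases lt_or_gt_of_ne (Finset.ne_of_mem_erase hj) with h | h
  · rw [if_neg h.not_gt, one_mul]
    exact sub_pos.2 (hv h)
  · rw [if_pos h]
    linarith [hv h]

open Polynomial in
/-- A polynomial of degree at most `6` that is nonnegative at eight points and vanishes at every
second one of them is zero. -/
theorem eq_zero_of_alternating {v : Fin 8 → ℝ} (hv : StrictMono v) {q : ℝ[X]}
    (hdeg : q.natDegree ≤ 6) (hq : ∀ i, 0 ≤ q.eval (v i)) (r : ℕ)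
    (hzero : ∀ i : Fin 8, i.val % 2 = r → q.eval (v i) = 0) (hr : r < 2) : q = 0 := by
  have hlt : q.degree < (Finset.univ : Finset (Fin 8)).card :=
    (natDegree_le_iff_degree_le.1 hdeg).trans_lt (by norm_num)
  -- The coefficient of degree 7, which is zero, as the divided difference of `q` at the eight
  -- nodes.
  have hsum := Lagrange.coeff_eq_sum (s := Finset.univ) (v := v) hv.injective.injOn hlt
  rw [coeff_eq_zero_of_natDegree_lt (by simp; omega)] at hsum
  -- There are `7 - i` negative factors, so the denominators alternate in sign.
  have hsign : ∀ i : Fin 8, (∏ j ∈ Finset.univ.erase i, if i < j then (-1 : ℝ) else 1)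
      = -(-1) ^ i.val := by
    intro i
    have h : (∏ j ∈ Finset.univ.erase i, if i < j then (-1 : ℤ) else 1) = -(-1) ^ i.val := by
      revert i
      decide
    exact_mod_cast congrArg (Int.cast : ℤ → ℝ) h
  have hpos : ∀ i, 0 < -(-1) ^ i.val * ∏ j ∈ Finset.univ.erase i, (v i - v j) := fun i =>
    hsign i ▸ sign_mul_prod_sub_pos hv i
  -- Only the nodes of parity `1 - r` contribute. Their denominators all have the sign `(-1) ^ r`,
  -- so the terms of a zero sum share one sign and all vanish.
  have hterm : ∀ i ∈ (Finset.univ : Finset (Fin 8)),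
      0 ≤ (-1) ^ r * (q.eval (v i) / ∏ j ∈ Finset.univ.erase i, (v i - v j)) := by
    intro i _
    by_cases hi : i.val % 2 = r
    · simp [hzero i hi]
    · have hp : (-1 : ℝ) ^ r = -(-1) ^ i.val := by
        rw [neg_one_pow_eq_pow_mod_two (n := i.val)]
        have : i.val % 2 = 1 - r := by omega
        rw [this]
        interval_cases r <;> norm_num
      have h := hpos i
      rw [← hp] at h
      have h2 : ((-1 : ℝ) ^ r)⁻¹ = (-1) ^ r := by interval_cases r <;> norm_num
      rw [mul_div_assoc', mul_comm, mul_div_assoc, ← h2, inv_div_left]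
      exact mul_nonneg (hq i) (inv_nonneg.2 (by rw [mul_comm]; exact h.le))
  have hall := (Finset.sum_eq_zero_iff_of_nonneg hterm).1
    (by rw [← Finset.mul_sum, ← hsum, mul_zero])
  refine eq_zero_of_degree_lt_of_eval_index_eq_zero (s := Finset.univ) (v := v)
    hv.injective.injOn hlt fun i hi => ?_
  have h0 : (∏ j ∈ Finset.univ.erase i, (v i - v j)) ≠ 0 := (right_ne_zero_of_mul (hpos i).ne')
  have := hall i hi
  simpa [h0] using this

/-- A simplex of `∂C_6(9)` misses an index of each parity among the first eight. -/
theorem exists_not_mem_of_mem_cyclicBoundary {t : Fin 9 → ℝ} (ht : StrictMono t)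
    {σ : Finset (Fin 9)} (h : σ ∈ (cyclicBoundary 6 t).faces) {r : ℕ} (hr : r < 2) :
    ∃ i : Fin 8, i.val % 2 = r ∧ i.castSucc ∉ σ := by
  by_contra! hall
  obtain ⟨q, hdeg, hq, ⟨k, hk⟩, hσ⟩ := exists_polynomial_of_mem_cyclicBoundary h
  refine hk ?_
  rw [eq_zero_of_alternating (v := fun i : Fin 8 => t i.castSucc)
    (ht.comp (Fin.strictMono_castSucc)) hdeg (fun i => hq _) r (fun i hi => hσ _ (hall i hi)) hr]
  simp

/-! ### Simplices formed by adjacent pairs -/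

open Polynomial in
/-- A quadratic polynomial that vanishes at two cyclically adjacent parameters and is positive at
all the others. -/
def adjacentPolynomial (t : Fin 9 → ℝ) (a : Fin 9) : ℝ[X] :=
  -- Addition in `Fin 9` is cyclic: for `a = 8` the pair consists of the two extreme parameters,
  -- between which the monic quadratic is negative.
  C (if a = 8 then -1 else 1) * ((X - C (t a)) * (X - C (t (a + 1))))

open Polynomial in
theorem natDegree_adjacentPolynomial_le (t : Fin 9 → ℝ) (a : Fin 9) :
    (adjacentPolynomial t a).natDegree ≤ 2 := by
  unfold adjacentPolynomial
  compute_degree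

open Polynomial in
theorem eval_adjacentPolynomial_pos {t : Fin 9 → ℝ} (ht : StrictMono t) {a i : Fin 9}
    (h : i ≠ a) (h' : i ≠ a + 1) : 0 < (adjacentPolynomial t a).eval (t i) := by
  have key : (a = 8 ∧ a + 1 < i ∧ i < a) ∨ (a ≠ 8 ∧ a < i ∧ a + 1 < i) ∨
      (a ≠ 8 ∧ i < a ∧ i < a + 1) := by
    revert a i
    decide
  simp only [adjacentPolynomial, eval_mul, eval_C, eval_sub, eval_X]
  rcases key with ⟨h8, h1, h2⟩ | ⟨h8, h1, h2⟩ | ⟨h8, h1, h2⟩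
  · rw [if_pos h8, neg_one_mul, ← neg_mul]
    exact mul_pos (by linarith [ht h2]) (by linarith [ht h1])
  · rw [if_neg h8, one_mul]
    exact mul_pos (by linarith [ht h1]) (by linarith [ht h2])
  · rw [if_neg h8, one_mul]
    exact mul_pos_of_neg_of_neg (by linarith [ht h1]) (by linarith [ht h2])

open Polynomial in
theorem eval_adjacentPolynomial_eq_zero (t : Fin 9 → ℝ) {a i : Fin 9}
    (h : i = a ∨ i = a + 1) : (adjacentPolynomial t a).eval (t i) = 0 := by
  rcases h with rfl | rfl <;> simp [adjacentPolynomial]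

theorem eval_adjacentPolynomial_nonneg {t : Fin 9 → ℝ} (ht : StrictMono t) (a i : Fin 9) :
    0 ≤ (adjacentPolynomial t a).eval (t i) := by
  by_cases h : i = a ∨ i = a + 1
  · exact (eval_adjacentPolynomial_eq_zero t h).ge
  · rw [not_or] at h
    exact (eval_adjacentPolynomial_pos ht h.1 h.2).le

open Polynomial in
/-- A union of three cyclically adjacent pairs is a simplex of `∂C_6(9)`. -/
theorem union_adjacent_mem_cyclicBoundary {t : Fin 9 → ℝ} (ht : StrictMono t) (a b c : Fin 9) :
    ({a, a + 1, b, b + 1, c, c + 1} : Finset (Fin 9)) ∈ (cyclicBoundary 6 t).faces := by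
  -- Six indices cannot exhaust nine; at a remaining one the product is positive, so the face is
  -- proper.
  have hmissing : ∃ k : Fin 9, (k ≠ a ∧ k ≠ a + 1) ∧ (k ≠ b ∧ k ≠ b + 1) ∧ (k ≠ c ∧ k ≠ c + 1) := by
    by_contra! hall
    have hsub : (Finset.univ : Finset (Fin 9)) ⊆ {a, a + 1, b, b + 1, c, c + 1} := by
      intro k _
      have := hall k
      simp only [Finset.mem_insert, Finset.mem_singleton]
      tauto
    have := (Finset.card_le_card hsub).trans Finset.card_le_six
    simp at this
  obtain ⟨k, ha, hb, hc⟩ := hmissing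
  refine mem_cyclicBoundary_of_polynomial
    (q := adjacentPolynomial t a * adjacentPolynomial t b * adjacentPolynomial t c) ?_ (fun i => ?_)
    ⟨k, ?_⟩ (Finset.insert_nonempty _ _) fun i hi => ?_
  · have h2 := natDegree_adjacentPolynomial_le t
    exact natDegree_mul_le_of_le (natDegree_mul_le_of_le (h2 a) (h2 b)) (h2 c)
  · simp only [eval_mul]
    have h0 := eval_adjacentPolynomial_nonneg ht
    exact mul_nonneg (mul_nonneg (h0 a i) (h0 b i)) (h0 c i)
  · simp only [eval_mul]
    exact (mul_pos (mul_pos (eval_adjacentPolynomial_pos ht ha.1 ha.2)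
      (eval_adjacentPolynomial_pos ht hb.1 hb.2)) (eval_adjacentPolynomial_pos ht hc.1 hc.2)).ne'
  · have h0 := fun a => eval_adjacentPolynomial_eq_zero t (a := a) (i := i)
    simp only [Finset.mem_insert, Finset.mem_singleton] at hi
    simp only [eval_mul, mul_eq_zero]
    rcases hi with h | h | h | h | h | h
    · exact Or.inl (Or.inl (h0 a (Or.inl h)))
    · exact Or.inl (Or.inl (h0 a (Or.inr h)))
    · exact Or.inl (Or.inr (h0 b (Or.inl h)))
    · exact Or.inl (Or.inr (h0 b (Or.inr h)))
    · exact Or.inr (h0 c (Or.inl h))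
    · exact Or.inr (h0 c (Or.inr h))

/-! ### The obstruction over `𝔽₂` -/

/-- There is no `3 × 9` matrix over `𝔽₂` such that, whenever the complement of three columns is
covered by three cyclically adjacent pairs, these columns have nonzero determinant. -/
theorem exists_det_eq_zero_of_adjacent_pairs (A : Matrix (Fin 3) (Fin 9) (ZMod 2)) :
    ∃ a b c p q r : Fin 9, (∀ i ∉ ({p, p + 1, q, q + 1, r, r + 1} : Finset (Fin 9)),
      i = a ∨ i = b ∨ i = c) ∧ (A.submatrix id ![a, b, c]).det = 0 := by
  by_contra! hA
  have hA1 : ∀ a b c p q r : Fin 9, (∀ i ∉ ({p, p + 1, q, q + 1, r, r + 1} : Finset (Fin 9)),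
      i = a ∨ i = b ∨ i = c) → (A.submatrix id ![a, b, c]).det = 1 := by
    have h2 : ∀ x : ZMod 2, x ≠ 0 → x = 1 := by decide
    exact fun a b c p q r h => h2 _ (hA a b c p q r h)
  -- Row reduction: multiplying by `M⁻¹` turns columns 0, 1, 2 into the identity and keeps all the
  -- determinants in question equal to 1.
  set M := A.submatrix id ![0, 1, 2]
  have hMdet : M.det = 1 := hA1 0 1 2 3 5 7 (by decide)
  have hMM : M⁻¹ * M = 1 := Matrix.nonsing_inv_mul M (by rw [hMdet]; exact isUnit_one)
  obtain ⟨B, hB⟩ : ∃ B, B = M⁻¹ * A := ⟨_, rfl⟩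
  have hsub : ∀ f : Fin 3 → Fin 9, B.submatrix id f = M⁻¹ * A.submatrix id f := by
    intro f
    rw [hB]
    rfl
  have hdet : ∀ a b c p q r : Fin 9, (∀ i ∉ ({p, p + 1, q, q + 1, r, r + 1} : Finset (Fin 9)),
      i = a ∨ i = b ∨ i = c) → (B.submatrix id ![a, b, c]).det = 1 := by
    intro a b c p q r h
    rw [hsub, Matrix.det_mul, hA1 a b c p q r h, Matrix.det_nonsing_inv, hMdet]
    simp
  have hone : ∀ i j, B i (![0, 1, 2] j) = (1 : Matrix (Fin 3) (Fin 3) (ZMod 2)) i j := by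
    intro i j
    rw [← hMM, ← hsub]
    rfl
  have e00 : B 0 0 = 1 := hone 0 0
  have e10 : B 1 0 = 0 := hone 1 0
  have e20 : B 2 0 = 0 := hone 2 0
  have e01 : B 0 1 = 0 := hone 0 1
  have e11 : B 1 1 = 1 := hone 1 1
  have e21 : B 2 1 = 0 := hone 2 1
  have e02 : B 0 2 = 0 := hone 0 2
  have e12 : B 1 2 = 0 := hone 1 2
  have e22 : B 2 2 = 1 := hone 2 2
  -- The first six determinants contain two unit columns, so each fixes one entry: the bottom
  -- entries of columns 4, 6, 8 and the top entries of columns 3, 5, 7 are 1. The other nine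
  -- constrain the remaining twelve bits.
  have d014 := hdet 0 1 4 2 5 7 (by decide)
  have d016 := hdet 0 1 6 2 4 7 (by decide)
  have d018 := hdet 0 1 8 2 4 6 (by decide)
  have d123 := hdet 1 2 3 4 6 8 (by decide)
  have d125 := hdet 1 2 5 3 6 8 (by decide)
  have d127 := hdet 1 2 7 3 5 8 (by decide)
  have d034 := hdet 0 3 4 1 5 7 (by decide)
  have d056 := hdet 0 5 6 1 3 7 (by decide)
  have d234 := hdet 2 3 4 0 5 7 (by decide)
  have d236 := hdet 2 3 6 0 4 7 (by decide)
  have d278 := hdet 2 7 8 0 3 5 (by decide)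
  have d345 := hdet 3 4 5 1 6 8 (by decide)
  have d456 := hdet 4 5 6 0 2 7 (by decide)
  have d478 := hdet 4 7 8 0 2 5 (by decide)
  have d567 := hdet 5 6 7 1 3 8 (by decide)
  simp only [Matrix.det_fin_three, Matrix.submatrix_apply, id_eq, Matrix.cons_val_zero,
    Matrix.cons_val_one, Matrix.cons_val, e00, e10, e20, e01, e11, e21, e02, e12, e22,
    zero_mul, mul_zero, one_mul, mul_one, add_zero, zero_add, CharTwo.sub_eq_add]
    at d014 d016 d018 d123 d125 d127 d034 d056 d234 d236 d278 d345 d456 d478 d567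
  simp only [d014, d016, d018, d123, d125, d127, one_mul, mul_one]
    at d034 d056 d234 d236 d278 d345 d456 d478 d567
  -- Each equation stands as soon as its variables are bound, so that the exhaustive search prunes
  -- early.
  have key : ∀ y3 z3 y4 : ZMod 2, y3 + y4 * z3 = 1 → ∀ x4 : ZMod 2, y4 + x4 * y3 = 1 →
      ∀ y5 z5 : ZMod 2, y4 * z5 + y5 + x4 * y3 * z5 + x4 * y5 * z3 + y3 + y4 * z3 = 1 →
      ∀ y6 : ZMod 2, y5 + y6 * z5 = 1 → ∀ x6 : ZMod 2, y6 + x6 * y3 = 1 →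
      x4 * y5 + x4 * y6 * z5 + y4 + y6 + x6 * y4 * z5 + x6 * y5 = 1 →
      ∀ y7 z7 : ZMod 2, y6 * z7 + y7 + x6 * y5 * z7 + x6 * y7 * z5 + y5 + y6 * z5 = 1 →
      ∀ y8 x8 : ZMod 2, y8 + x8 * y7 = 1 →
      ¬ x4 * y7 + x4 * y8 * z7 + y4 + y8 + x8 * y4 * z7 + x8 * y7 = 1 := by
    decide
  exact key _ _ _ d034 _ d234 _ _ d345 _ d056 _ d236 d456 _ _ d567 _ _ d278 d478

/-! ### Free actions and 2-torsion -/

/-- An element of a freely acting subgroup that is `1` off a simplex `σ` is trivial, as it fixes a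
point of the piece `Z_σ`. -/
theorem ActsFreelyOn.eq_one_of_forall_notMem {m : ℕ} {H : Subgroup (Torus m)}
    {K : PreAbstractSimplicialComplex (Fin m)} (h : ActsFreelyOn H K) {g : Torus m} (hg : g ∈ H)
    {σ : Finset (Fin m)} (hσ : σ ∈ K.faces) (hone : ∀ i ∉ σ, g i = 1) : g = 1 := by
  refine h g hg ⟨fun i => if i ∈ σ then 0 else 1, σ, Or.inr hσ, fun i => ?_⟩ ?_
  · by_cases hi : i ∈ σ <;> simp [hi]
  · refine Subtype.ext (funext fun i => ?_)
    change (g i : ℂ) * (if i ∈ σ then 0 else 1) = if i ∈ σ then 0 else 1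
    by_cases hi : i ∈ σ <;> simp [hi, hone]

/-- The square roots of 1 are `±1`, and the injective character `ZMod.toCircle` takes the value `-1`
at 1. -/
theorem exists_toCircle_eq {w : Circle} (hw : w ^ 2 = 1) :
    ∃ a : ZMod 2, ZMod.toCircle a = w := by
  have hsq : ∀ {u : Circle}, u ^ 2 = 1 → (u : ℂ) = 1 ∨ (u : ℂ) = -1 := fun {u} hu =>
    by
    rw [← sq_eq_sq_iff_eq_or_eq_neg, ← Circle.coe_pow, hu, Circle.coe_one, one_pow]
  have h1 : (ZMod.toCircle (1 : ZMod 2)) ^ 2 = 1 := by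
    rw [← AddChar.map_nsmul_eq_pow, CharTwo.two_nsmul, AddChar.map_zero_eq_one]
  have h2 : (ZMod.toCircle (1 : ZMod 2) : ℂ) = -1 := by
    refine (hsq h1).resolve_left fun h => one_ne_zero (α := ZMod 2) ?_
    refine ZMod.injective_toCircle ?_
    rw [AddChar.map_zero_eq_one]
    exact Circle.ext h
  rcases hsq hw with h | h
  · exact ⟨0, by rw [AddChar.map_zero_eq_one]; exact Circle.ext h.symm⟩
  · exact ⟨1, Circle.ext (h2.trans h.symm)⟩

/-- On the `2`-torsion, a homomorphism of tori is given by a matrix over `𝔽₂`. -/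
theorem exists_matrix_toCircle {k m : ℕ} (φ : Torus k →* Torus m) :
    ∃ A : Matrix (Fin k) (Fin m) (ZMod 2), ∀ v i,
      φ (fun j => ZMod.toCircle (v j)) i = ZMod.toCircle (Matrix.vecMul v A i) := by
  have h1 : ∀ a : ZMod 2, (ZMod.toCircle a) ^ 2 = 1 := fun a => by
    rw [← AddChar.map_nsmul_eq_pow, CharTwo.two_nsmul, AddChar.map_zero_eq_one]
  have h2 : ∀ j i, ∃ a : ZMod 2,
      ZMod.toCircle a = φ (Pi.mulSingle j (ZMod.toCircle (1 : ZMod 2))) i := by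
    intro j i
    apply exists_toCircle_eq
    rw [← Pi.pow_apply, ← map_pow, ← Pi.mulSingle_pow, h1, Pi.mulSingle_one, map_one, Pi.one_apply]
  choose A hA using h2
  refine ⟨A, fun v i => ?_⟩
  have h3 : ∀ a b : ZMod 2, ZMod.toCircle (a * b) = ZMod.toCircle b ^ a.val := by
    intro a b
    rw [← AddChar.map_nsmul_eq_pow, nsmul_eq_mul, ZMod.natCast_zmod_val]
  have hv : (fun j => ZMod.toCircle (v j)) =
      ∏ j, (Pi.mulSingle j (ZMod.toCircle (1 : ZMod 2)) : Torus k) ^ (v j).val := by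
    rw [← Finset.univ_prod_mulSingle (fun j => ZMod.toCircle (v j))]
    refine Finset.prod_congr rfl fun j _ => ?_
    rw [← Pi.mulSingle_pow, ← h3, mul_one]
  change _ = ZMod.toCircle (∑ j, v j * A j i)
  rw [hv, map_prod, Finset.prod_apply]
  refine Eq.trans ?_ (map_prod ZMod.toCircle.toMonoidHom
    (fun j => Multiplicative.ofAdd (v j * A j i)) Finset.univ).symm
  refine Finset.prod_congr rfl fun j _ => ?_
  rw [map_pow, Pi.pow_apply, ← hA, ← h3]
  rfl

/-- A nonzero vector killed by three dependent columns gives a nontrivial involution in the image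
that is 1 off a simplex, so it has a fixed point. -/
theorem not_actsFreelyOn_range {t : Fin 9 → ℝ} (ht : StrictMono t) {φ : Torus 3 →* Torus 9}
    (hφ : Function.Injective φ) : ¬ ActsFreelyOn φ.range (cyclicBoundary 6 t) := by
  intro hfree
  obtain ⟨A, hA⟩ := exists_matrix_toCircle φ
  obtain ⟨a, b, c, p, q, r, hcov, hdet⟩ := exists_det_eq_zero_of_adjacent_pairs A
  obtain ⟨v, hv, hvA⟩ := Matrix.exists_vecMul_eq_zero_iff.2 hdet
  have hcol : ∀ j, Matrix.vecMul v A (![a, b, c] j) = 0 := fun j => congrFun hvA j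
  have h1 := hfree.eq_one_of_forall_notMem ⟨fun j => ZMod.toCircle (v j), rfl⟩
    (union_adjacent_mem_cyclicBoundary ht p q r) fun i hi => by
      rw [hA]
      have h0 : Matrix.vecMul v A i = 0 := by
        rcases hcov i hi with rfl | rfl | rfl
        exacts [hcol 0, hcol 1, hcol 2]
      rw [h0, AddChar.map_zero_eq_one]
  have h2 : (fun j => ZMod.toCircle (v j)) = (1 : Torus 3) := hφ (h1.trans (map_one φ).symm)
  refine hv (funext fun j => ZMod.injective_toCircle ?_)
  rw [Pi.zero_apply, AddChar.map_zero_eq_one]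
  exact congrFun h2 j

theorem exists_injective_torusHom_of_le {k d : ℕ} (h : k ≤ d) :
    ∃ ψ : Torus k →* Torus d, Function.Injective ψ := by
  have hinj := Fin.castLE_injective h
  refine ⟨Function.ExtendByOne.hom Circle (Fin.castLE h), fun x y hxy => funext fun j => ?_⟩
  have := congrFun hxy (Fin.castLE h j)
  simpa [hinj.extend_apply] using this

/-- A subtorus that acts freely on `Z_{∂C_6(9)}` has dimension at most `2`. -/
theorem dim_le_two_of_actsFreelyOn {t : Fin 9 → ℝ} (ht : StrictMono t) {H : Subgroup (Torus 9)}
    {d : ℕ} (hd : IsSubtorusOfDim H d) (hfree : ActsFreelyOn H (cyclicBoundary 6 t)) : d ≤ 2 := by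
  by_contra! h
  obtain ⟨e⟩ := hd
  obtain ⟨ψ, hψ⟩ := exists_injective_torusHom_of_le (k := 3) h
  refine not_actsFreelyOn_range ht (φ := H.subtype.comp (e.toMulEquiv.toMonoidHom.comp ψ))
    (H.subtype_injective.comp (e.injective.comp hψ)) fun g hg => hfree g ?_
  obtain ⟨x, rfl⟩ := hg
  exact SetLike.coe_mem _

/-! ### Torsion and inclusions of tori -/

theorem card_torsion_torus (d n : ℕ) [NeZero n] : Nat.card {x : Torus d // x ^ n = 1} = n ^ d := by
  let e : {x : Torus d // x ^ n = 1} ≃ (Fin d → rootsOfUnity n Circle) :=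
    { toFun := fun x i => rootsOfUnity.mkOfPowEq (x.1 i) (congrFun x.2 i)
      invFun := fun y => ⟨fun i => ((y i : Circleˣ) : Circle), funext fun i =>
        (mem_rootsOfUnity' n _).1 (y i).2⟩
      left_inv := fun _ => rfl
      right_inv := fun _ => funext fun _ => Subtype.ext (Units.ext rfl) }
  rw [Nat.card_congr e, Nat.card_pi, Finset.prod_const, HasEnoughRootsOfUnity.natCard_rootsOfUnity,
    Finset.card_univ, Fintype.card_fin]

theorem denseRange_circleExp_ratCast :
    DenseRange fun q : ℚ => Circle.exp (2 * Real.pi * q) := by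
  have hsurj : Function.Surjective fun x : ℝ => Circle.exp (2 * Real.pi * x) := fun z => by
    obtain ⟨y, rfl⟩ := Circle.exp_surjective z
    exact ⟨y / (2 * Real.pi), congrArg Circle.exp (mul_div_cancel₀ y Real.two_pi_pos.ne')⟩
  exact hsurj.denseRange.comp Rat.denseRange_cast (by fun_prop)

theorem circleExp_ratCast_pow_eq_one {q : ℚ} {n : ℕ} (h : q.den ∣ n) :
    Circle.exp (2 * Real.pi * q) ^ n = 1 := by
  obtain ⟨k, rfl⟩ := h
  have hq : (q.den : ℝ) * q = q.num := by exact_mod_cast Rat.den_mul_eq_num q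
  rw [pow_mul, ← Circle.exp_nsmul, nsmul_eq_mul, mul_left_comm, hq, mul_comm,
    Circle.exp_int_mul_two_pi, one_pow]

/-- The torsion elements of a torus are dense. -/
theorem dense_torsion_torus (d : ℕ) : Dense {x : Torus d | ∃ n : ℕ, n ≠ 0 ∧ x ^ n = 1} := by
  refine (DenseRange.piMap fun _ : Fin d => denseRange_circleExp_ratCast).mono ?_
  rintro _ ⟨q, rfl⟩
  refine ⟨∏ i, (q i).den, Finset.prod_ne_zero_iff.2 fun i _ => (q i).den_nz, funext fun i => ?_⟩
  exact circleExp_ratCast_pow_eq_one (Finset.dvd_prod_of_mem _ (Finset.mem_univ i))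

/-- A torus contained in a torus of at most the same dimension is the whole of it. -/
theorem IsSubtorusOfDim.le_of_le {m k d : ℕ} {S H : Subgroup (Torus m)}
    (hS : IsSubtorusOfDim S k) (hH : IsSubtorusOfDim H d) (hdk : d ≤ k) (hSH : S ≤ H) : H ≤ S := by
  obtain ⟨e⟩ := hS
  obtain ⟨e'⟩ := hH
  have hclosed : IsClosed (S : Set (Torus m)) := by
    have : CompactSpace S := e.toHomeomorph.compactSpace
    exact (isCompact_iff_compactSpace.2 this).isClosed
  let ψ : Torus k →* Torus d :=
    e'.symm.toMulEquiv.toMonoidHom.comp ((Subgroup.inclusion hSH).comp e.toMulEquiv.toMonoidHom)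
  have hψ : Function.Injective ψ :=
    e'.symm.injective.comp ((Subgroup.inclusion_injective hSH).comp e.injective)
  have hψ' : ∀ x, (e' (ψ x) : Torus m) = e x := fun x =>
    congrArg Subtype.val (e'.apply_symm_apply (Subgroup.inclusion hSH (e x)))
  have htors : ∀ y : Torus d, (∃ n : ℕ, n ≠ 0 ∧ y ^ n = 1) → (e' y : Torus m) ∈ S := by
    rintro y ⟨n, hn, hy⟩
    have : NeZero n := ⟨hn⟩
    let f : {x : Torus k // x ^ n = 1} → {x : Torus d // x ^ n = 1} := fun x =>
      ⟨ψ x, by rw [← map_pow, x.2, map_one]⟩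
    have hf : Function.Injective f := fun x x' h => Subtype.ext (hψ (congrArg Subtype.val h))
    have hfin : Finite {x : Torus d // x ^ n = 1} :=
      Nat.finite_of_card_ne_zero (by rw [card_torsion_torus]; exact pow_ne_zero _ hn)
    -- An injection from `n ^ k` elements into `n ^ d ≤ n ^ k` is onto, so `S` contains all the
    -- torsion of `H`. This torsion is dense in `H`, and `S` is closed.
    have hbij := hf.bijective_of_nat_card_le (by
      rw [card_torsion_torus, card_torsion_torus]
      exact Nat.pow_le_pow_right (Nat.pos_of_ne_zero hn) hdk)
    obtain ⟨x, hx⟩ := hbij.2 ⟨y, hy⟩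
    have hx' : ψ x = y := congrArg Subtype.val hx
    rw [← hx', hψ']
    exact SetLike.coe_mem _
  intro h hh
  have hcont : Continuous fun y : Torus d => (e' y : Torus m) :=
    continuous_subtype_val.comp e'.continuous
  have := (hclosed.preimage hcont).closure_subset_iff.2 htors
    (dense_torsion_torus d (e'.symm ⟨h, hh⟩))
  simpa using this

/-! ### The given 2-torus -/

theorem continuous_torusHom {k m : ℕ} (A : Matrix (Fin k) (Fin m) ℤ) :
    Continuous (torusHom A) := by
  refine continuous_pi fun i => ?_
  change Continuous fun s : Torus k => ∏ j, s j ^ A j i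
  fun_prop

/-- A continuous injection of a compact space into a Hausdorff space is an embedding, so the image
carries the topology of `T^k`. -/
theorem isSubtorusOfDim_range_torusHom {k m : ℕ} {A : Matrix (Fin k) (Fin m) ℤ}
    (hA : Function.Injective (torusHom A)) : IsSubtorusOfDim (torusHom A).range k := by
  have hemb : Topology.IsEmbedding (torusHom A) :=
    ((continuous_torusHom A).isClosedEmbedding hA).isEmbedding
  exact ⟨{ hemb.toHomeomorph with
    map_mul' := fun x y => Subtype.ext (map_mul (torusHom A) x y) }⟩

theorem torusHom_subtorusMatrix_apply (s : Torus 2) (i : Fin 9) :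
    torusHom subtorusMatrix s i = s 0 ^ subtorusMatrix 0 i * s 1 ^ subtorusMatrix 1 i := by
  simp [torusHom, Fin.prod_univ_two]

/-- Among the first eight columns (counted from 0), the even ones read off `s 0` and the odd ones `s
1`. -/
theorem eq_one_of_torusHom_subtorusMatrix {s : Torus 2} {i j : Fin 8} (hi : i.val % 2 = 0)
    (hj : j.val % 2 = 1) (h0 : torusHom subtorusMatrix s i.castSucc = 1)
    (h1 : torusHom subtorusMatrix s j.castSucc = 1) : s = 1 := by
  rw [torusHom_subtorusMatrix_apply] at h0 h1
  have hmat : ∀ i : Fin 8, subtorusMatrix 0 i.castSucc = (if i.val % 2 = 0 then 1 else 0) ∧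
      subtorusMatrix 1 i.castSucc = (if i.val % 2 = 0 then 0 else 1) := by
    decide
  rw [(hmat i).1, (hmat i).2, if_pos hi, if_pos hi, zpow_one, zpow_zero, mul_one] at h0
  rw [(hmat j).1, (hmat j).2, if_neg (by omega), if_neg (by omega), zpow_one, zpow_zero,
    one_mul] at h1
  funext l
  fin_cases l
  exacts [h0, h1]

theorem injective_torusHom_subtorusMatrix : Function.Injective (torusHom subtorusMatrix) :=
  (injective_iff_map_eq_one _).2 fun s hs =>
    eq_one_of_torusHom_subtorusMatrix (i := 0) (j := 1) rfl rfl
      (by rw [hs, Pi.one_apply]) (by rw [hs, Pi.one_apply])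

theorem actsFreelyOn_range_torusHom_subtorusMatrix {t : Fin 9 → ℝ} (ht : StrictMono t) :
    ActsFreelyOn (torusHom subtorusMatrix).range (cyclicBoundary 6 t) := by
  rintro _ ⟨s, rfl⟩ ⟨z, σ, hσ, hz⟩ hfix
  -- Off `σ` the coordinate `z i` has norm 1, so it can be cancelled from the fixed-point equation.
  have hone : ∀ i ∉ σ, torusHom subtorusMatrix s i = 1 := by
    intro i hi
    have h : (torusHom subtorusMatrix s i : ℂ) * z i = z i := congrFun (congrArg Subtype.val hfix) i
    have hzi : z i ≠ 0 := norm_ne_zero_iff.1 (by rw [(hz i).2 hi]; exact one_ne_zero)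
    exact Circle.ext (mul_right_cancel₀ hzi (h.trans (by simp)))
  have hmiss : ∀ r < 2, ∃ i : Fin 8, i.val % 2 = r ∧ i.castSucc ∉ σ := by
    intro r hr
    rcases hσ with rfl | hσ
    · exact ⟨⟨r, by omega⟩, Nat.mod_eq_of_lt hr, Finset.notMem_empty _⟩
    · exact exists_not_mem_of_mem_cyclicBoundary ht hσ hr
  obtain ⟨i, hi, hi'⟩ := hmiss 0 (by norm_num)
  obtain ⟨j, hj, hj'⟩ := hmiss 1 (by norm_num)
  rw [eq_one_of_torusHom_subtorusMatrix hi hj (hone _ hi') (hone _ hj'), map_one]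

end

theorem mainTheorem7 (t : Fin 9 → ℝ) (ht : StrictMono t) :
    ∃ T : Subgroup (Torus 9),
      T = (torusHom subtorusMatrix).range ∧
      IsSubtorusOfDim T 2 ∧
      ActsFreelyOn T (cyclicBoundary 6 t) ∧
      Maximal (fun H : Subgroup (Torus 9) =>
        IsSubtorus H ∧ ActsFreelyOn H (cyclicBoundary 6 t)) T ∧
      ¬ ∃ H : Subgroup (Torus 9),
        IsSubtorusOfDim H 3 ∧ ActsFreelyOn H (cyclicBoundary 6 t) := by
  have hdim := isSubtorusOfDim_range_torusHom injective_torusHom_subtorusMatrix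
  have hfree := actsFreelyOn_range_torusHom_subtorusMatrix ht
  refine ⟨_, rfl, hdim, hfree, ⟨⟨⟨2, hdim⟩, hfree⟩, ?_⟩, ?_⟩
  · rintro H ⟨⟨d, hd⟩, hH⟩ hle
    exact hdim.le_of_le hd (dim_le_two_of_actsFreelyOn ht hd hH) hle
  · rintro ⟨H, hH, hH'⟩
    exact absurd (dim_le_two_of_actsFreelyOn ht hH hH') (by norm_num)
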